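/- Let $\kappa\ge 1$ be an integer. A finite list $m=(m_1,\dots,m_n)$ of half-integers (numbers $m_i$ with $2m_i\in\mathbb{Z}$) is called a $\kappa$-permissible list of spin components if $\sum_{i=1}^n|m_i|=\kappa/2$. A finite list $b=(b_1,\dots,b_n)$ of non-zero elements of $\mathbb{Z}_\kappa=\mathbb{Z}/\kappa\mathbb{Z}$ is called $\kappa$-permissible if $b_1+\cdots+b_n=0$ in $\mathbb{Z}_\kappa$ and there is a $\kappa$-permissible list of spin components $(m_1,\dots,m_n)$ of the same length with $b_i\equiv-2m_i \pmod{\kappa}$ for all $i$. Let $\mathcal{B}_\kappa$ be the set of all $\kappa$-permissible lists of non-zero elements of $\mathbb{Z}_\kappa$ (lists of all lengths $n$). The entropy of a quantum horizon of area $a_\kappa=4\pi\gamma\ell_P^2\kappa$ (where $\gamma$ and $\ell_P$ are fixed positive constants) is $S_{\rm bh}(a_\kappa)=\log\big(|\mathcal{B}_\kappa|+1\big)$. Then $\mathcal{B}_\kappa$ is finite for every integer $\kappa\ge1$, and the following hold, the arguments of the logarithms being positive. For every integer $u\ge 1$, $$S_{\rm bh}(a_{2u})=\log\left(\frac{(-1)^u\sqrt{\pi}}{4\,\Gamma(3/2-u)\,u!}\;{}_2F_1\big(1/2,-u;\,3/2-u;\,9\big)+2^{2u}-2^{u-1}(u+3)-2u+2\right),$$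 where $\Gamma$ is the Gamma function and ${}_2F_1$ is the Gauss hypergeometric function, given here by its terminating series. For every integer $u\ge 0$, $$S_{\rm bh}(a_{2u+1})=\log\left(2^{2u+1}-2u-1\right).$$ -/

import Mathlib

/-- A half-integer: a number `x` such that `2 x` is an integer (integers, in particular `0`,
are included). -/
def IsHalfInteger (x : ℚ) : Prop :=
  ∃ k : ℤ, 2 * x = (k : ℚ)

/-- A list `m = (m₁, …, mₙ)` of half-integers is a `κ`-permissible list of spin components
if `∑ |mᵢ| = κ / 2`. -/
def IsPermissibleSpinList (κ : ℕ) (m : List ℚ) : Prop :=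
  (∀ x ∈ m, IsHalfInteger x) ∧ (m.map fun x => |x|).sum = (κ : ℚ) / 2

/-- `b = -2 x (mod κ)`, for `b ∈ ℤ / κ` and a half-integer `x`: the residue class of the
integer `-2 x` is `b`. -/
def EqNegTwoMulMod (κ : ℕ) (b : ZMod κ) (x : ℚ) : Prop :=
  ∃ k : ℤ, (k : ℚ) = -2 * x ∧ b = (k : ZMod κ)

/-- A list `b = (b₁, …, bₙ)` of non-zero elements of `ℤ / κ` is `κ`-permissible if its sum is `0`
and, for some `κ`-permissible list of spin components `m = (m₁, …, mₙ)` of the same length,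
`bᵢ = -2 mᵢ (mod κ)` for every `i`. -/
def IsPermissibleBList (κ : ℕ) (b : List (ZMod κ)) : Prop :=
  (∀ x ∈ b, x ≠ 0) ∧ b.sum = 0 ∧
    ∃ m : List ℚ, IsPermissibleSpinList κ m ∧ List.Forall₂ (EqNegTwoMulMod κ) b m

/-- The set of all `κ`-permissible `b`-lists. -/
def permissibleBLists (κ : ℕ) : Set (List (ZMod κ)) :=
  {b | IsPermissibleBList κ b}

/-- The entropy of a quantum horizon of area `a_κ`, as a function of the level `κ`:
`log (|B_κ| + 1)`, where the `1` accounts for the trivial sequence. -/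
noncomputable def blackHoleEntropy (κ : ℕ) : ℝ :=
  Real.log (((permissibleBLists κ).ncard : ℝ) + 1)

/-!
Replacing `mᵢ` by the integer `kᵢ = -2 mᵢ`, a permissible list is the residue mod `κ` of a list of
non-zero integers of absolute value less than `κ` with `∑ |kᵢ| = κ` and `κ ∣ ∑ kᵢ`. The sum is then
`κ`, `-κ` or `0`, so the positive entries sum to `κ`, `0` or `κ / 2`.

Two such lists `k ≠ k'` with the same residues differ in places where the entries have opposite
signs and absolute values summing to `κ`. As the absolute values in `k` and `k'` sum to `2 κ`
altogether, either they differ in two places and have length two, or they differ in a single place,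
where one has `κ / 2` and the other `-κ / 2` (`eq_or_differ_once_or_le`). Hence every permissible
list has exactly one representative (`canonicalLists`) whose entries are all positive, or all
negative and at least three in number, or which has at least two entries of each sign
(`injOn_canonicalLists`, `exists_canonical`). The first two families have `2 ^ (κ - 1) - 1` and
`2 ^ (κ - 1) - κ` members. The third is empty for odd `κ`; for `κ = 2 u` it consists of the signed
compositions with positive part `u` and negative part `-u`, less those with a single entry of one
sign (`ncard_twoNegative_twoPositive`).

Splitting off the head of a list shows that the number of signed compositions with positive part `i`
and negative part `-j` has the generating function `(1 - x) (1 - y) / (1 - 2x - 2y + 3xy)`. The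
coefficients of `F = 1 / (1 - 2x - 2y + 3xy)` satisfy, besides the evident recurrence, the relation
given by `(2 - 3x) ∂F/∂x = (2 - 3y) ∂F/∂y` (`cumulativeCount_derivative`), and together these give a
three-term recurrence along the diagonal (`ncard_signedCompositions_diagonal_rec`). On the other
side, the hypergeometric term is half the coefficient of `z ^ u` in `((1 - z) / (1 - 9 z)) ^ (1 / 2)`
(`hypergeometric_term_eq`), and the differential equation `(1 - z) (1 - 9 z) A' = 4 A` of this power
series is the same recurrence (`sqrtQuotientCoeff_rec`).
-/

/-! ### The hypergeometric term as a coefficient of a power series -/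

/-- The coefficient of `zⁿ` in `(1 - c z) ^ (-a)`. -/
noncomputable def binomialCoeff (a c : ℝ) (n : ℕ) : ℝ :=
  (ascPochhammer ℝ n).eval a / (n.factorial : ℝ) * c ^ n

theorem succ_mul_binomialCoeff (a c : ℝ) (n : ℕ) :
    ((n : ℝ) + 1) * binomialCoeff a c (n + 1) = c * (a + n) * binomialCoeff a c n := by
  unfold binomialCoeff
  rw [ascPochhammer_succ_eval, Nat.factorial_succ]
  push_cast
  have : (n.factorial : ℝ) ≠ 0 := by positivity
  field_simp
  ring

/-- The formal power series `(1 - c z) ^ (-a)`. -/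
noncomputable def binomialPowerSeries (a c : ℝ) : PowerSeries ℝ :=
  PowerSeries.mk (binomialCoeff a c)

theorem derivative_binomialPowerSeries (a c : ℝ) :
    (1 - PowerSeries.C c * PowerSeries.X) * PowerSeries.derivative ℝ (binomialPowerSeries a c) =
      PowerSeries.C (c * a) * binomialPowerSeries a c := by
  ext n
  rw [sub_mul, one_mul, mul_assoc, map_sub, PowerSeries.coeff_C_mul, PowerSeries.coeff_C_mul]
  cases n with
  | zero =>
    have := succ_mul_binomialCoeff a c 0
    simp [binomialPowerSeries, PowerSeries.coeff_derivative] at this ⊢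
    linarith
  | succ n =>
    have := succ_mul_binomialCoeff a c (n + 1)
    simp only [binomialPowerSeries, PowerSeries.coeff_succ_X_mul, PowerSeries.coeff_derivative,
      PowerSeries.coeff_mk]
    push_cast at this ⊢
    linarith

/-- The coefficient of `zⁿ` in `((1 - z) / (1 - 9 z)) ^ (1 / 2)`. -/
noncomputable def sqrtQuotientCoeff (n : ℕ) : ℝ :=
  PowerSeries.coeff n (binomialPowerSeries (1 / 2) 9 * binomialPowerSeries (-1 / 2) 1)

/-- With `A = ((1 - z) / (1 - 9 z)) ^ (1 / 2)`, this is `(1 - z) (1 - 9 z) A' = 4 A`. -/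
theorem sqrtQuotient_ode :
    (1 - PowerSeries.C 10 * PowerSeries.X + PowerSeries.C 9 * (PowerSeries.X * PowerSeries.X)) *
        PowerSeries.derivative ℝ (binomialPowerSeries (1 / 2) 9 * binomialPowerSeries (-1 / 2) 1) =
      PowerSeries.C 4 * (binomialPowerSeries (1 / 2) 9 * binomialPowerSeries (-1 / 2) 1) := by
  have h1 := derivative_binomialPowerSeries (1 / 2) 9
  have h2 := derivative_binomialPowerSeries (-1 / 2) 1
  rw [Derivation.leibniz, smul_eq_mul, smul_eq_mul]
  have e1 : (PowerSeries.C (10 : ℝ)) = PowerSeries.C 9 + 1 := by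
    rw [← map_one PowerSeries.C, ← map_add]; norm_num
  have e2 : (PowerSeries.C (4 : ℝ)) = PowerSeries.C (9 * (1 / 2)) + PowerSeries.C (1 * (-1 / 2)) := by
    rw [← map_add]; norm_num
  have e3 : (PowerSeries.C (9 * (1 / 2) : ℝ)) + PowerSeries.C 9 * PowerSeries.C (1 * (-1 / 2)) = 0 := by
    rw [← map_mul, ← map_add]; norm_num
  rw [map_one, one_mul] at h2
  rw [e1, e2]
  linear_combination binomialPowerSeries (-1 / 2) 1 * (1 - PowerSeries.X) * h1 +
    binomialPowerSeries (1 / 2) 9 * (1 - PowerSeries.C 9 * PowerSeries.X) * h2 -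
    PowerSeries.X * binomialPowerSeries (1 / 2) 9 * binomialPowerSeries (-1 / 2) 1 * e3

theorem sqrtQuotientCoeff_zero : sqrtQuotientCoeff 0 = 1 := by
  simp [sqrtQuotientCoeff, binomialPowerSeries, binomialCoeff, PowerSeries.coeff_mul]

theorem sqrtQuotientCoeff_one : sqrtQuotientCoeff 1 = 4 := by
  have := congrArg (PowerSeries.coeff 0) sqrtQuotient_ode
  have h0 := sqrtQuotientCoeff_zero
  unfold sqrtQuotientCoeff at *
  rw [add_mul, sub_mul, mul_assoc, mul_assoc, mul_assoc] at this
  rw [map_add, map_sub] at this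
  simp only [PowerSeries.coeff_C_mul, PowerSeries.coeff_zero_X_mul, one_mul,
    PowerSeries.coeff_derivative, h0] at this
  simpa using this

theorem sqrtQuotientCoeff_rec (n : ℕ) :
    ((n : ℝ) + 2) * sqrtQuotientCoeff (n + 2) =
      (10 * (n : ℝ) + 14) * sqrtQuotientCoeff (n + 1) - 9 * n * sqrtQuotientCoeff n := by
  have := congrArg (PowerSeries.coeff (n + 1)) sqrtQuotient_ode
  rw [add_mul, sub_mul, mul_assoc, mul_assoc, mul_assoc, map_add, map_sub] at this
  simp only [PowerSeries.coeff_C_mul, PowerSeries.coeff_succ_X_mul, one_mul,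
    PowerSeries.coeff_derivative] at this
  cases n with
  | zero =>
    simp only [PowerSeries.coeff_zero_X_mul] at this
    unfold sqrtQuotientCoeff
    push_cast at this ⊢
    linarith
  | succ n =>
    simp only [PowerSeries.coeff_succ_X_mul, PowerSeries.coeff_derivative] at this
    unfold sqrtQuotientCoeff
    push_cast at this ⊢
    linarith

theorem ascPochhammer_eval_neg_mul_factorial (k n : ℕ) :
    (ascPochhammer ℝ k).eval (-((k + n : ℕ) : ℝ)) * (n.factorial : ℝ) =
      (-1) ^ k * ((k + n).factorial : ℝ) := by
  induction k generalizing n with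
  | zero => simp
  | succ k ih =>
    have := ih (n + 1)
    rw [Nat.factorial_succ, show k + (n + 1) = k + 1 + n by ring] at this
    rw [ascPochhammer_succ_eval, pow_succ]
    push_cast at this ⊢
    linear_combination -this

/-- Reversing the factors of `(-1/2) (1/2) (3/2) ⋯`. -/
theorem ascPochhammer_eval_reflect (k n : ℕ) :
    (ascPochhammer ℝ k).eval (3 / 2 - ((k + n : ℕ) : ℝ)) * (ascPochhammer ℝ n).eval (-1 / 2) =
      (-1) ^ k * (ascPochhammer ℝ (k + n)).eval (-1 / 2) := by
  induction k generalizing n with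
  | zero => simp
  | succ k ih =>
    have := ih (n + 1)
    rw [show k + (n + 1) = k + 1 + n by ring, ascPochhammer_succ_eval] at this
    rw [ascPochhammer_succ_eval, pow_succ]
    push_cast at this ⊢
    linear_combination -this

theorem ascPochhammer_eval_neg_half_ne_zero (n : ℕ) :
    (ascPochhammer ℝ n).eval (-1 / 2 : ℝ) ≠ 0 := by
  induction n with
  | zero => simp
  | succ n ih =>
    rw [ascPochhammer_succ_eval]
    refine mul_ne_zero ih fun h => ?_
    have : (2 * n : ℝ) = 1 := by linarith
    have : 2 * n = 1 := by exact_mod_cast this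
    omega

theorem Gamma_three_half_sub_nat (n : ℕ) :
    Real.Gamma (3 / 2 - (n : ℝ)) * ((-1) ^ n * (ascPochhammer ℝ n).eval (-1 / 2)) =
      Real.sqrt Real.pi / 2 := by
  induction n with
  | zero =>
    have := Real.Gamma_add_one (s := 1 / 2) (by norm_num)
    rw [Real.Gamma_one_half_eq] at this
    norm_num at this ⊢
    linarith
  | succ n ih =>
    have hne : (1 / 2 - (n : ℝ)) ≠ 0 := fun h => by
      have : (2 * n : ℝ) = 1 := by linarith
      have : 2 * n = 1 := by exact_mod_cast this
      omega
    have := Real.Gamma_add_one hne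
    rw [show 1 / 2 - (n : ℝ) + 1 = 3 / 2 - n by ring] at this
    rw [this] at ih
    rw [ascPochhammer_succ_eval, pow_succ, ← ih]
    push_cast
    rw [show 3 / 2 - ((n : ℝ) + 1) = 1 / 2 - n by ring]
    ring

/-- The series, which terminates because `(-u)ₖ = 0` for `k > u`, as a finite convolution: up to
the factor `1 / 2`, the term of index `k` is the product of the coefficients of `zᵏ` in
`(1 - 9 z) ^ (-1 / 2)` and of `z ^ (u - k)` in `(1 - z) ^ (1 / 2)`. -/
theorem hypergeometric_term_eq (u : ℕ) :
    (-1 : ℝ) ^ u * Real.sqrt Real.pi /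
        (4 * Real.Gamma (3 / 2 - (u : ℝ)) * (Nat.factorial u : ℝ)) *
        ordinaryHypergeometric (1 / 2 : ℝ) (-(u : ℝ)) (3 / 2 - (u : ℝ)) (9 : ℝ) =
      sqrtQuotientCoeff u / 2 := by
  rw [ordinaryHypergeometric_eq_tsum]
  dsimp only
  rw [tsum_eq_sum (s := Finset.range (u + 1))]
  · rw [sqrtQuotientCoeff, PowerSeries.coeff_mul,
      Finset.Nat.sum_antidiagonal_eq_sum_range_succ_mk, Finset.mul_sum, Finset.sum_div]
    refine Finset.sum_congr rfl fun k hk => ?_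
    obtain ⟨n, rfl⟩ := Nat.exists_eq_add_of_le (Nat.lt_succ_iff.mp (Finset.mem_range.mp hk))
    simp only [binomialPowerSeries, PowerSeries.coeff_mk, binomialCoeff, add_tsub_cancel_left,
      one_pow, mul_one, smul_eq_mul]
    have h1 := ascPochhammer_eval_neg_mul_factorial k n
    have h2 := ascPochhammer_eval_reflect k n
    have h3 := Gamma_three_half_sub_nat (k + n)
    have hn := ascPochhammer_eval_neg_half_ne_zero n
    have hkn := ascPochhammer_eval_neg_half_ne_zero (k + n)
    have fn : (n.factorial : ℝ) ≠ 0 := by positivity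
    have fk : (k.factorial : ℝ) ≠ 0 := by positivity
    have fkn : ((k + n).factorial : ℝ) ≠ 0 := by positivity
    have hs : ((-1 : ℝ) ^ (k + n)) * (-1) ^ (k + n) = 1 := by
      rw [← mul_pow]; norm_num
    have hs0 : (-1 : ℝ) ^ (k + n) ≠ 0 := by positivity
    have hs0' : (-1 : ℝ) ^ k ≠ 0 := by positivity
    have hpi : Real.sqrt Real.pi ≠ 0 := by positivity
    rw [eq_div_of_mul_eq fn h1, eq_div_of_mul_eq hn h2,
      eq_div_of_mul_eq (mul_ne_zero hs0 hkn) h3]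
    generalize (ascPochhammer ℝ n).eval (-1 / 2 : ℝ) = p at *
    generalize (ascPochhammer ℝ (k + n)).eval (-1 / 2 : ℝ) = q at *
    field_simp
    linear_combination 4 * (ascPochhammer ℝ k).eval (1 / 2 : ℝ) * hs
  · intro k hk
    have hk : u < k := by simpa using hk
    have : (ascPochhammer ℝ k).eval (-(u : ℝ)) = 0 := ascPochhammer_eval_neg_coe_nat_of_lt hk
    rw [this]
    simp

/-! ### Counting signed compositions -/

/-- The sum of the positive entries of a list of integers. -/
def posSum (l : List ℤ) : ℕ := (l.map Int.toNat).sum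

/-- The sum of the absolute values of the negative entries of a list of integers. -/
def negSum (l : List ℤ) : ℕ := (l.map fun x => (-x).toNat).sum

/-- The number of positive entries of a list of integers. -/
def posCount (l : List ℤ) : ℕ := l.countP fun x => 0 < x

/-- The number of negative entries of a list of integers. -/
def negCount (l : List ℤ) : ℕ := l.countP fun x => x < 0

@[simp] theorem posSum_nil : posSum [] = 0 := rfl
@[simp] theorem negSum_nil : negSum [] = 0 := rfl
@[simp] theorem posCount_nil : posCount [] = 0 := rfl
@[simp] theorem negCount_nil : negCount [] = 0 := rfl

@[simp] theorem posSum_cons (x : ℤ) (l : List ℤ) : posSum (x :: l) = x.toNat + posSum l := by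
  simp [posSum]

@[simp] theorem negSum_cons (x : ℤ) (l : List ℤ) : negSum (x :: l) = (-x).toNat + negSum l := by
  simp [negSum]

@[simp] theorem posCount_cons (x : ℤ) (l : List ℤ) :
    posCount (x :: l) = posCount l + if 0 < x then 1 else 0 := by
  simp [posCount, List.countP_cons]

@[simp] theorem negCount_cons (x : ℤ) (l : List ℤ) :
    negCount (x :: l) = negCount l + if x < 0 then 1 else 0 := by
  simp [negCount, List.countP_cons]

@[simp] theorem posSum_append (p s : List ℤ) : posSum (p ++ s) = posSum p + posSum s := by
  simp [posSum]

@[simp] theorem negSum_append (p s : List ℤ) : negSum (p ++ s) = negSum p + negSum s := by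
  simp [negSum]

@[simp] theorem posCount_append (p s : List ℤ) :
    posCount (p ++ s) = posCount p + posCount s := by
  simp [posCount]

@[simp] theorem negCount_append (p s : List ℤ) :
    negCount (p ++ s) = negCount p + negCount s := by
  simp [negCount]

theorem posSum_map_neg (l : List ℤ) : posSum (l.map Neg.neg) = negSum l := by
  induction l with
  | nil => rfl
  | cons x l ih => simp [ih]

theorem negSum_map_neg (l : List ℤ) : negSum (l.map Neg.neg) = posSum l := by
  induction l with
  | nil => rfl
  | cons x l ih => simp [ih]

theorem posCount_map_neg (l : List ℤ) : posCount (l.map Neg.neg) = negCount l := by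
  induction l with
  | nil => rfl
  | cons x l ih => simp [ih]

theorem posCount_eq_zero_iff {l : List ℤ} : posCount l = 0 ↔ posSum l = 0 := by
  induction l with
  | nil => simp
  | cons x l ih =>
    rw [posCount_cons, posSum_cons, Nat.add_eq_zero_iff, Nat.add_eq_zero_iff, ih, and_comm,
      Int.toNat_eq_zero]
    simp

theorem negCount_eq_zero_iff {l : List ℤ} : negCount l = 0 ↔ negSum l = 0 := by
  rw [← posCount_map_neg, ← posSum_map_neg, posCount_eq_zero_iff]

theorem posCount_add_negCount {l : List ℤ} (h : 0 ∉ l) : posCount l + negCount l = l.length := by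
  induction l with
  | nil => rfl
  | cons x l ih =>
    simp only [List.mem_cons, not_or] at h
    have := ih h.2
    have := h.1
    rw [posCount_cons, negCount_cons, List.length_cons]
    split_ifs <;> omega

theorem length_le_posSum_add_negSum {l : List ℤ} (h : 0 ∉ l) :
    l.length ≤ posSum l + negSum l := by
  induction l with
  | nil => simp
  | cons x l ih =>
    simp only [List.mem_cons, not_or] at h
    have := ih h.2
    have := h.1
    rw [posSum_cons, negSum_cons, List.length_cons]
    omega

theorem le_posSum_and_neg_le_negSum {l : List ℤ} {x : ℤ} (h : x ∈ l) :
    x ≤ posSum l ∧ -x ≤ negSum l := by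
  induction l with
  | nil => simp at h
  | cons y l ih =>
    rw [posSum_cons, negSum_cons]
    rcases List.mem_cons.mp h with rfl | h
    · omega
    · have := ih h
      omega

/-- Signed compositions: the lists of non-zero integers whose positive entries sum to `i` and
whose negative entries sum to `-j`. -/
def signedCompositions (i j : ℕ) : Set (List ℤ) :=
  {l | 0 ∉ l ∧ posSum l = i ∧ negSum l = j}

/-- The lists with head `g a`, where `g 0, g 1, …` stand for entries of size `1, 2, …`, and with
tail in the member of the family `A` indexed by the size that is left over from the total `i`. -/
def consSet (g : ℕ → ℤ) (A : ℕ → Set (List ℤ)) (i : ℕ) : Set (List ℤ) :=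
  {l | ∃ a r t, a + 1 + r = i ∧ t ∈ A r ∧ l = g a :: t}

theorem consSet_succ (g : ℕ → ℤ) (A : ℕ → Set (List ℤ)) (i : ℕ) :
    consSet g A (i + 1) = (List.cons (g 0)) '' A i ∪ consSet (fun a => g (a + 1)) A i := by
  ext l
  constructor
  · rintro ⟨a, r, t, h, ht, rfl⟩
    cases a with
    | zero =>
      obtain rfl : r = i := by omega
      exact Or.inl ⟨t, ht, rfl⟩
    | succ a => exact Or.inr ⟨a, r, t, by omega, ht, rfl⟩
  · rintro (⟨t, ht, rfl⟩ | ⟨a, r, t, h, ht, rfl⟩)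
    · exact ⟨0, i, t, by omega, ht, rfl⟩
    · exact ⟨a + 1, r, t, by omega, ht, rfl⟩

theorem consSet_finite_ncard {g : ℕ → ℤ} (hg : Function.Injective g) {A : ℕ → Set (List ℤ)}
    (i : ℕ) (hA : ∀ r < i, (A r).Finite) :
    (consSet g A i).Finite ∧ (consSet g A i).ncard = ∑ r ∈ Finset.range i, (A r).ncard := by
  induction i generalizing g with
  | zero =>
    have : consSet g A 0 = ∅ := by
      ext l
      constructor
      · rintro ⟨a, r, t, h, -⟩
        omega
      · exact False.elim
    simp [this]
  | succ i ih =>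
    have hg' : Function.Injective fun a => g (a + 1) := fun a b h => Nat.succ_injective (hg h)
    obtain ⟨hf, hc⟩ := ih hg' fun r hr => hA r (hr.trans i.lt_succ_self)
    have hi := hA i i.lt_succ_self
    rw [consSet_succ]
    refine ⟨(hi.image _).union hf, ?_⟩
    rw [Set.ncard_union_eq _ (hi.image _) hf, hc, Finset.sum_range_succ,
      Set.ncard_image_of_injective _ (List.cons_injective), add_comm]
    rw [Set.disjoint_left]
    rintro _ ⟨t, -, rfl⟩ ⟨a, r, t', -, -, h⟩
    exact absurd (hg (List.cons.inj h).1) (by omega)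

theorem posHead_injective : Function.Injective fun a : ℕ => (a : ℤ) + 1 := fun a b h => by
  simpa using h

theorem negHead_injective : Function.Injective fun a : ℕ => -((a : ℤ) + 1) := fun a b h => by
  have : -((a : ℤ) + 1) = -((b : ℤ) + 1) := h
  omega

/-- A signed composition is empty, or has a positive head, or has a negative head. -/
theorem signedCompositions_eq (i j : ℕ) :
    signedCompositions i j = (if i = 0 ∧ j = 0 then {[]} else ∅) ∪
      (consSet (fun a => (a : ℤ) + 1) (fun r => signedCompositions r j) i ∪
        consSet (fun a => -((a : ℤ) + 1)) (fun r => signedCompositions i r) j) := by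
  ext l
  constructor
  · rintro ⟨h0, hi, hj⟩
    cases l with
    | nil => left; rw [if_pos ⟨hi.symm, hj.symm⟩]; rfl
    | cons x l =>
      simp only [List.mem_cons, not_or, posSum_cons, negSum_cons] at h0 hi hj
      rcases lt_or_gt_of_ne h0.1 with h | h
      · refine Or.inr (Or.inl ⟨x.toNat - 1, posSum l, l, by omega, ⟨h0.2, rfl, by omega⟩, ?_⟩)
        congr 1
        dsimp only
        omega
      · refine Or.inr (Or.inr ⟨(-x).toNat - 1, negSum l, l, by omega, ⟨h0.2, by omega, rfl⟩, ?_⟩)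
        congr 1
        dsimp only
        omega
  · rintro (h | ⟨a, r, t, h, ⟨h0, hi, hj⟩, rfl⟩ | ⟨a, r, t, h, ⟨h0, hi, hj⟩, rfl⟩)
    · split_ifs at h with hij
      · obtain rfl : l = [] := h
        exact ⟨by simp, hij.1.symm, hij.2.symm⟩
      · exact h.elim
    all_goals
      dsimp only
      refine ⟨?_, ?_, ?_⟩
      · simp only [List.mem_cons, not_or]
        exact ⟨by omega, h0⟩
      · rw [posSum_cons]; omega
      · rw [negSum_cons]; omega

theorem signedCompositions_finite (i j : ℕ) : (signedCompositions i j).Finite := by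
  induction h : i + j using Nat.strong_induction_on generalizing i j with
  | _ n ih =>
    rw [signedCompositions_eq]
    refine Set.Finite.union (by split_ifs <;> simp) (Set.Finite.union ?_ ?_)
    · exact (consSet_finite_ncard posHead_injective i fun r hr => ih _ (by omega) r j rfl).1
    · exact (consSet_finite_ncard negHead_injective j fun r hr => ih _ (by omega) i r rfl).1

theorem ncard_signedCompositions (i j : ℕ) :
    (signedCompositions i j).ncard = (if i = 0 ∧ j = 0 then 1 else 0) +
      (∑ r ∈ Finset.range i, (signedCompositions r j).ncard +
        ∑ r ∈ Finset.range j, (signedCompositions i r).ncard) := by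
  obtain ⟨f1, c1⟩ := consSet_finite_ncard posHead_injective (A := fun r => signedCompositions r j)
    i fun r _ => signedCompositions_finite r j
  obtain ⟨f2, c2⟩ := consSet_finite_ncard negHead_injective (A := fun r => signedCompositions i r)
    j fun r _ => signedCompositions_finite i r
  rw [signedCompositions_eq, Set.ncard_union_eq _ (by split_ifs <;> simp) (f1.union f2),
    Set.ncard_union_eq _ f1 f2, c1, c2]
  · congr 1
    split_ifs <;> simp
  · rw [Set.disjoint_left]
    rintro _ ⟨a, r, t, -, -, rfl⟩ ⟨b, r', t', -, -, h⟩
    have := (List.cons.inj h).1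
    dsimp only at this
    omega
  · rw [Set.disjoint_left]
    rintro l hl (⟨a, r, t, -, -, rfl⟩ | ⟨b, r, t, -, -, rfl⟩) <;>
    · split_ifs at hl
      · simp at hl
      · exact hl

theorem ncard_signedCompositions_succ_zero (n : ℕ) :
    (signedCompositions (n + 1) 0).ncard = 2 ^ n := by
  have key : ∀ i, ∑ r ∈ Finset.range (i + 1), (signedCompositions r 0).ncard = 2 ^ i := by
    intro i
    induction i with
    | zero => rw [Finset.sum_range_one, ncard_signedCompositions]; simp
    | succ i ih =>
      rw [Finset.sum_range_succ, ncard_signedCompositions (i + 1) 0, ih]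
      simp
      ring
  rw [ncard_signedCompositions, key]
  simp

theorem image_neg_signedCompositions (i j : ℕ) :
    (List.map Neg.neg) '' signedCompositions i j = signedCompositions j i := by
  have neg_neg : ∀ l : List ℤ, (l.map Neg.neg).map Neg.neg = l := fun l => by simp
  ext l
  constructor
  · rintro ⟨t, ⟨h0, hi, hj⟩, rfl⟩
    exact ⟨by simpa using h0, by rw [posSum_map_neg, hj], by rw [negSum_map_neg, hi]⟩
  · rintro ⟨h0, hi, hj⟩
    exact ⟨l.map Neg.neg, ⟨by simpa using h0, by rw [posSum_map_neg, hj],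
      by rw [negSum_map_neg, hi]⟩, neg_neg l⟩

theorem map_neg_injective : Function.Injective (List.map (Neg.neg : ℤ → ℤ)) :=
  List.map_injective_iff.mpr neg_injective

theorem ncard_signedCompositions_comm (i j : ℕ) :
    (signedCompositions i j).ncard = (signedCompositions j i).ncard := by
  rw [← image_neg_signedCompositions i j, Set.ncard_image_of_injective _ map_neg_injective]

/-- The number of signed compositions whose positive entries sum to at most `i` and whose negative
entries sum to at least `-j`. Its generating function is `1 / (1 - 2x - 2y + 3xy)`. -/
noncomputable def cumulativeCount (i j : ℕ) : ℝ :=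
  ∑ r ∈ Finset.range (i + 1), ∑ s ∈ Finset.range (j + 1), ((signedCompositions r s).ncard : ℝ)

theorem cumulativeCount_comm (i j : ℕ) : cumulativeCount i j = cumulativeCount j i := by
  unfold cumulativeCount
  rw [Finset.sum_comm]
  simp only [ncard_signedCompositions_comm]

theorem sum_row (i j : ℕ) : ∑ s ∈ Finset.range (j + 1), ((signedCompositions (i + 1) s).ncard : ℝ) =
    cumulativeCount (i + 1) j - cumulativeCount i j := by
  unfold cumulativeCount
  rw [Finset.sum_range_succ _ (i + 1)]
  ring

theorem sum_column (i j : ℕ) :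
    ∑ r ∈ Finset.range (i + 1), ((signedCompositions r (j + 1)).ncard : ℝ) =
      cumulativeCount i (j + 1) - cumulativeCount i j := by
  rw [cumulativeCount_comm i, cumulativeCount_comm i, ← sum_row]
  simp only [ncard_signedCompositions_comm]

theorem ncard_signedCompositions_succ_succ (i j : ℕ) :
    ((signedCompositions (i + 1) (j + 1)).ncard : ℝ) =
      cumulativeCount i (j + 1) + cumulativeCount (i + 1) j - 2 * cumulativeCount i j := by
  rw [ncard_signedCompositions]
  push_cast
  rw [sum_row, sum_column]
  simp
  ring

theorem cumulativeCount_succ_succ (i j : ℕ) :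
    cumulativeCount (i + 1) (j + 1) =
      2 * cumulativeCount i (j + 1) + 2 * cumulativeCount (i + 1) j - 3 * cumulativeCount i j := by
  have h1 := sum_row i j
  have h2 := sum_row i (j + 1)
  rw [Finset.sum_range_succ, h1, ncard_signedCompositions_succ_succ] at h2
  linarith

theorem cumulativeCount_zero_right (i : ℕ) : cumulativeCount i 0 = 2 ^ i := by
  unfold cumulativeCount
  simp only [zero_add, Finset.sum_range_one]
  induction i with
  | zero => rw [zero_add, Finset.sum_range_one, ncard_signedCompositions]; simp
  | succ i ih => rw [Finset.sum_range_succ, ih, ncard_signedCompositions_succ_zero]; push_cast; ring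

theorem cumulativeCount_one_right (i : ℕ) : cumulativeCount i 1 = 2 ^ i * (i + 4) / 2 := by
  induction i with
  | zero => rw [cumulativeCount_comm, cumulativeCount_zero_right]; norm_num
  | succ i ih =>
    rw [cumulativeCount_succ_succ, ih, cumulativeCount_zero_right, cumulativeCount_zero_right]
    push_cast
    ring

/-- With `F = 1 / (1 - 2x - 2y + 3xy)`, this is `(2 - 3x) ∂F/∂x = (2 - 3y) ∂F/∂y` in coefficients. -/
theorem cumulativeCount_derivative (i j : ℕ) :
    2 * ((i : ℝ) + 1) * cumulativeCount (i + 1) j - 2 * ((j : ℝ) + 1) * cumulativeCount i (j + 1) =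
      3 * ((i : ℝ) - j) * cumulativeCount i j := by
  induction i generalizing j with
  | zero =>
    rw [cumulativeCount_comm _ j, cumulativeCount_comm _ j, cumulativeCount_comm 0,
      cumulativeCount_one_right, cumulativeCount_zero_right, cumulativeCount_zero_right]
    push_cast
    ring
  | succ i ih =>
    induction j with
    | zero =>
      rw [cumulativeCount_one_right, cumulativeCount_zero_right, cumulativeCount_zero_right]
      push_cast
      ring
    | succ j ihj =>
      have h1 := cumulativeCount_succ_succ (i + 1) j
      have h2 := cumulativeCount_succ_succ i (j + 1)
      have h3 := cumulativeCount_succ_succ i j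
      have h4 := ih (j + 1)
      have h5 := ih j
      push_cast at *
      linear_combination 2 * ((i : ℝ) + 2) * h1 - 2 * ((j : ℝ) + 2) * h2 -
        3 * ((i : ℝ) - j) * h3 + 2 * h4 + 2 * ihj - 3 * h5

theorem cumulativeCount_diagonal (n : ℕ) :
    cumulativeCount (n + 1) (n + 1) =
      4 * cumulativeCount (n + 1) n - 3 * cumulativeCount n n := by
  rw [cumulativeCount_succ_succ, cumulativeCount_comm n (n + 1)]
  ring

theorem cumulativeCount_subdiagonal (n : ℕ) :
    ((n : ℝ) + 2) * cumulativeCount (n + 2) (n + 1) =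
      (4 * n + 6) * cumulativeCount (n + 1) (n + 1) - (3 * n + 3) * cumulativeCount (n + 1) n := by
  have h1 := cumulativeCount_succ_succ (n + 1) n
  have h2 := cumulativeCount_derivative (n + 1) n
  push_cast at h2
  linear_combination ((n : ℝ) + 2) * h1 + h2

theorem ncard_signedCompositions_diagonal (n : ℕ) :
    ((signedCompositions (n + 1) (n + 1)).ncard : ℝ) =
      2 * (cumulativeCount (n + 1) n - cumulativeCount n n) := by
  rw [ncard_signedCompositions_succ_succ, cumulativeCount_comm n (n + 1)]
  ring

theorem ncard_signedCompositions_one_one : ((signedCompositions 1 1).ncard : ℝ) = 2 := by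
  rw [ncard_signedCompositions_diagonal 0, cumulativeCount_zero_right, cumulativeCount_zero_right]
  norm_num

theorem ncard_signedCompositions_two_two : ((signedCompositions 2 2).ncard : ℝ) = 14 := by
  have h1 := cumulativeCount_diagonal 0
  have h2 := cumulativeCount_subdiagonal 0
  have h3 := cumulativeCount_zero_right 0
  have h4 := cumulativeCount_zero_right 1
  rw [ncard_signedCompositions_diagonal 1]
  norm_num at *
  linarith

theorem ncard_signedCompositions_diagonal_rec (n : ℕ) :
    ((n : ℝ) + 3) * (signedCompositions (n + 3) (n + 3)).ncard =
      (10 * n + 24) * (signedCompositions (n + 2) (n + 2)).ncard -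
        9 * (n + 1) * (signedCompositions (n + 1) (n + 1)).ncard := by
  rw [ncard_signedCompositions_diagonal, ncard_signedCompositions_diagonal,
    ncard_signedCompositions_diagonal]
  have h1 := cumulativeCount_diagonal n
  have h2 := cumulativeCount_subdiagonal n
  have h3 := cumulativeCount_diagonal (n + 1)
  have h4 := cumulativeCount_subdiagonal (n + 1)
  push_cast at *
  linear_combination 2 * h4 + 2 * (3 * (n : ℝ) + 7) * h3 - 2 * h2 - 6 * ((n : ℝ) + 1) * h1

/-! ### Signed compositions with few entries of one sign -/

/-- A list whose only negative entry is `-(j + 1)` either starts with this entry, or has a positive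
head and again exactly one negative entry in its tail. -/
theorem oneNegative_eq (i j : ℕ) :
    {l | l ∈ signedCompositions i (j + 1) ∧ negCount l = 1} =
      consSet (fun a => (a : ℤ) + 1)
        (fun r => {l | l ∈ signedCompositions r (j + 1) ∧ negCount l = 1}) i ∪
      List.cons (-((j : ℤ) + 1)) '' signedCompositions i 0 := by
  ext l
  constructor
  · rintro ⟨⟨h0, hi, hj⟩, hc⟩
    cases l with
    | nil => simp at hc
    | cons x l =>
      simp only [List.mem_cons, not_or, posSum_cons, negSum_cons, negCount_cons] at h0 hi hj hc
      rcases lt_or_gt_of_ne h0.1 with h | h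
      · rw [if_neg (by omega)] at hc
        refine Or.inl ⟨x.toNat - 1, posSum l, l, by omega, ⟨⟨h0.2, rfl, by omega⟩, hc⟩, ?_⟩
        congr 1
        dsimp only
        omega
      · rw [if_pos h] at hc
        have : negSum l = 0 := negCount_eq_zero_iff.mp (by omega)
        refine Or.inr ⟨l, ⟨h0.2, by omega, this⟩, ?_⟩
        congr 1
        omega
  · rintro (⟨a, r, t, h, ⟨⟨h0, hi, hj⟩, hc⟩, rfl⟩ | ⟨t, ⟨h0, hi, hj⟩, rfl⟩)
    · dsimp only
      refine ⟨⟨?_, ?_, ?_⟩, ?_⟩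
      · simp only [List.mem_cons, not_or]
        exact ⟨by omega, h0⟩
      · rw [posSum_cons]; omega
      · rw [negSum_cons]; omega
      · rw [negCount_cons, if_neg (by omega), hc]
    · refine ⟨⟨?_, ?_, ?_⟩, ?_⟩
      · simp only [List.mem_cons, not_or]
        exact ⟨by omega, h0⟩
      · rw [posSum_cons]; omega
      · rw [negSum_cons]; omega
      · rw [negCount_cons, if_pos (by omega), negCount_eq_zero_iff.mpr hj]

theorem oneNegative_finite (i j : ℕ) :
    {l | l ∈ signedCompositions i j ∧ negCount l = 1}.Finite :=
  (signedCompositions_finite i j).subset fun _ h => h.1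

theorem ncard_oneNegative_eq_sum (i j : ℕ) :
    {l | l ∈ signedCompositions i (j + 1) ∧ negCount l = 1}.ncard =
      ∑ r ∈ Finset.range i, {l | l ∈ signedCompositions r (j + 1) ∧ negCount l = 1}.ncard +
        (signedCompositions i 0).ncard := by
  obtain ⟨hf, hc⟩ := consSet_finite_ncard posHead_injective
    (A := fun r => {l | l ∈ signedCompositions r (j + 1) ∧ negCount l = 1}) i
    fun r _ => oneNegative_finite r (j + 1)
  rw [oneNegative_eq, Set.ncard_union_eq _ hf ((signedCompositions_finite i 0).image _), hc,
    Set.ncard_image_of_injective _ List.cons_injective]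
  rw [Set.disjoint_left]
  rintro _ ⟨a, r, t, -, -, rfl⟩ ⟨t', -, h⟩
  have := (List.cons.inj h).1
  dsimp only at this
  omega

theorem ncard_oneNegative (n j : ℕ) :
    ({l | l ∈ signedCompositions (n + 1) (j + 1) ∧ negCount l = 1}.ncard : ℝ) =
      2 ^ n * (n + 4) / 2 := by
  have key : ∀ i, ∑ r ∈ Finset.range (i + 1),
      ({l | l ∈ signedCompositions r (j + 1) ∧ negCount l = 1}.ncard : ℝ) =
        2 ^ i * (i + 2) / 2 := by
    intro i
    induction i with
    | zero =>
      rw [Finset.sum_range_one, ncard_oneNegative_eq_sum, ncard_signedCompositions]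
      simp
    | succ i ih =>
      rw [Finset.sum_range_succ, ncard_oneNegative_eq_sum (i + 1),
        ncard_signedCompositions_succ_zero]
      push_cast
      rw [ih]
      ring
  rw [ncard_oneNegative_eq_sum, ncard_signedCompositions_succ_zero]
  push_cast
  rw [key]
  ring

theorem ncard_onePositive (n j : ℕ) :
    ({l | l ∈ signedCompositions (j + 1) (n + 1) ∧ posCount l = 1}.ncard : ℝ) =
      2 ^ n * (n + 4) / 2 := by
  rw [← ncard_oneNegative n j, ← Set.ncard_image_of_injective _ map_neg_injective]
  congr 2
  rw [← image_neg_signedCompositions (n + 1) (j + 1)]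
  ext l
  constructor
  · rintro ⟨_, ⟨⟨t, ht, rfl⟩, hc⟩, rfl⟩
    simpa [posCount_map_neg] using And.intro ht (posCount_map_neg t ▸ hc)
  · rintro ⟨ht, hc⟩
    exact ⟨l.map Neg.neg, ⟨⟨l, ht, rfl⟩, by rw [posCount_map_neg, hc]⟩, by simp⟩

theorem oneNegative_inter_onePositive (n : ℕ) :
    {l | l ∈ signedCompositions (n + 1) (n + 1) ∧ negCount l = 1} ∩
      {l | l ∈ signedCompositions (n + 1) (n + 1) ∧ posCount l = 1} =
      {[(n : ℤ) + 1, -((n : ℤ) + 1)], [-((n : ℤ) + 1), (n : ℤ) + 1]} := by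
  ext l
  constructor
  · rintro ⟨⟨⟨h0, hi, hj⟩, hn⟩, ⟨-, hp⟩⟩
    have hlen := posCount_add_negCount h0
    rw [hn, hp] at hlen
    obtain ⟨x, y, rfl⟩ := List.length_eq_two.mp hlen.symm
    simp only [posSum_cons, negSum_cons, posSum_nil, negSum_nil, negCount_cons, negCount_nil]
      at hi hj hn
    simp only [Set.mem_insert_iff, Set.mem_singleton_iff, List.cons.injEq, and_true]
    split_ifs at hn <;> omega
  · have h1 : (0 : ℤ) < n + 1 := by omega
    have h2 : -((n : ℤ) + 1) < 0 := by omega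
    have h3 : ¬ (0 : ℤ) < -((n : ℤ) + 1) := by omega
    have h4 : ¬ (n : ℤ) + 1 < 0 := by omega
    have h5 : (n + 1 : ℤ).toNat = n + 1 := by omega
    have h6 : (-(n + 1 : ℤ)).toNat = 0 := by omega
    have h7 : (n + 1 : ℤ) ≠ 0 := by omega
    rintro (rfl | rfl) <;>
    refine ⟨⟨⟨?_, ?_, ?_⟩, ?_⟩, ⟨⟨?_, ?_, ?_⟩, ?_⟩⟩ <;>
    simp only [posSum_cons, negSum_cons, posSum_nil, negSum_nil, negCount_cons, negCount_nil,
      posCount_cons, posCount_nil, List.mem_cons, List.not_mem_nil, or_false, if_pos h1, if_pos h2,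
      if_neg h3, if_neg h4, neg_neg, h5, h6] <;>
    (clear h5 h6; omega)

theorem ncard_oneNegative_union_onePositive (n : ℕ) :
    (({l | l ∈ signedCompositions (n + 1) (n + 1) ∧ negCount l = 1} ∪
      {l | l ∈ signedCompositions (n + 1) (n + 1) ∧ posCount l = 1} : Set (List ℤ)).ncard : ℝ) + 2 =
      2 ^ n * (n + 4) := by
  have hf : {l | l ∈ signedCompositions (n + 1) (n + 1) ∧ posCount l = 1}.Finite :=
    (signedCompositions_finite _ _).subset fun _ h => h.1
  have h := Set.ncard_union_add_ncard_inter
    {l | l ∈ signedCompositions (n + 1) (n + 1) ∧ negCount l = 1}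
    {l | l ∈ signedCompositions (n + 1) (n + 1) ∧ posCount l = 1} (oneNegative_finite (n + 1) (n + 1)) hf
  rw [oneNegative_inter_onePositive, Set.ncard_pair] at h
  · have h' := congrArg (Nat.cast (R := ℝ)) h
    push_cast at h'
    rw [h', ncard_oneNegative, ncard_onePositive]
    ring
  · intro h
    have := (List.cons.inj h).1
    omega

theorem ncard_twoNegative_twoPositive (n : ℕ) :
    ({l | l ∈ signedCompositions (n + 1) (n + 1) ∧ 2 ≤ posCount l ∧ 2 ≤ negCount l}.ncard : ℝ) =
      (signedCompositions (n + 1) (n + 1)).ncard - 2 ^ n * (n + 4) + 2 := by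
  have hs : {l | l ∈ signedCompositions (n + 1) (n + 1) ∧ 2 ≤ posCount l ∧ 2 ≤ negCount l} =
      signedCompositions (n + 1) (n + 1) \
        ({l | l ∈ signedCompositions (n + 1) (n + 1) ∧ negCount l = 1} ∪
          {l | l ∈ signedCompositions (n + 1) (n + 1) ∧ posCount l = 1}) := by
    ext l
    simp only [Set.mem_sdiff, Set.mem_ofPred_eq, Set.mem_union, not_or, not_and]
    constructor
    · rintro ⟨h, h1, h2⟩
      exact ⟨h, fun _ => by omega, fun _ => by omega⟩
    · rintro ⟨h, h1, h2⟩
      have h1 := h1 h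
      have h2 := h2 h
      obtain ⟨-, hi, hj⟩ := id h
      have h3 := mt posCount_eq_zero_iff.mp (show posSum l ≠ 0 by omega)
      have h4 := mt negCount_eq_zero_iff.mp (show negSum l ≠ 0 by omega)
      exact ⟨h, by omega, by omega⟩
  have hsub : ({l | l ∈ signedCompositions (n + 1) (n + 1) ∧ negCount l = 1} ∪
      {l | l ∈ signedCompositions (n + 1) (n + 1) ∧ posCount l = 1}) ⊆
        signedCompositions (n + 1) (n + 1) :=
    Set.union_subset (fun _ h => h.1) fun _ h => h.1
  have h := Set.ncard_sdiff_add_ncard_of_subset hsub (signedCompositions_finite _ _)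
  have h' := congrArg (Nat.cast (R := ℝ)) h
  push_cast at h'
  rw [hs]
  linarith [ncard_oneNegative_union_onePositive n]

/-! ### Permissible lists as residues of integer lists -/

theorem sum_eq_posSum_sub_negSum (l : List ℤ) : l.sum = posSum l - negSum l := by
  induction l with
  | nil => rfl
  | cons x l ih => rw [List.sum_cons, posSum_cons, negSum_cons, ih]; push_cast; omega

/-- The integer lists `(-2 m₁, …, -2 mₙ)` for the spin lists `m` that give permissible lists: the
entries are non-zero mod `κ`, their absolute values sum to `κ`, and `κ` divides their sum. As no
entry exceeds `κ` in absolute value, the first condition says that entries are non-zero and of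
absolute value less than `κ`. -/
def levelLists (κ : ℕ) : Set (List ℤ) :=
  {l | (∀ x ∈ l, x ≠ 0 ∧ |x| < κ) ∧ posSum l + negSum l = κ ∧ (κ : ℤ) ∣ l.sum}

theorem forall₂_eqNegTwoMulMod_iff {κ : ℕ} (b : List (ZMod κ)) (m : List ℚ) :
    List.Forall₂ (EqNegTwoMulMod κ) b m ↔
      ∃ l : List ℤ, b = l.map Int.cast ∧ m = l.map fun k : ℤ => -(k : ℚ) / 2 := by
  constructor
  · intro h
    induction h with
    | nil => exact ⟨[], rfl, rfl⟩
    | cons h _ ih =>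
      obtain ⟨k, hk, rfl⟩ := h
      obtain ⟨l, rfl, rfl⟩ := ih
      refine ⟨k :: l, rfl, ?_⟩
      rw [List.map_cons, hk]
      congr 1
      ring
  · rintro ⟨l, rfl, rfl⟩
    rw [List.forall₂_map_left_iff, List.forall₂_map_right_iff, List.forall₂_same]
    exact fun k _ => ⟨k, by ring, rfl⟩

theorem sum_abs_spins (l : List ℤ) :
    ((l.map fun k : ℤ => -(k : ℚ) / 2).map fun x => |x|).sum = ((posSum l + negSum l : ℕ) : ℚ) / 2 := by
  induction l with
  | nil => simp
  | cons x l ih =>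
    have h : |(x : ℚ)| = ((x.toNat + (-x).toNat : ℕ) : ℚ) := by
      have : |x| = ((x.toNat + (-x).toNat : ℕ) : ℤ) := by
        rw [abs_eq_max_neg]; omega
      exact_mod_cast congrArg (Int.cast (R := ℚ)) this
    rw [List.map_cons, List.map_cons, List.sum_cons, ih, abs_div, abs_neg, h, abs_two, posSum_cons,
      negSum_cons]
    push_cast
    ring

theorem permissibleBLists_eq_image (κ : ℕ) :
    permissibleBLists κ = List.map (Int.cast : ℤ → ZMod κ) '' levelLists κ := by
  have cast_sum : ∀ l : List ℤ, (l.map (Int.cast : ℤ → ZMod κ)).sum = (l.sum : ZMod κ) := fun l =>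
    (map_list_sum (Int.castRingHom (ZMod κ)) l).symm
  ext b
  constructor
  · rintro ⟨h0, hs, m, ⟨-, hm⟩, hf⟩
    obtain ⟨l, rfl, rfl⟩ := (forall₂_eqNegTwoMulMod_iff _ _).mp hf
    rw [sum_abs_spins] at hm
    have hm : posSum l + negSum l = κ := by
      have : ((posSum l + negSum l : ℕ) : ℚ) = κ := by linarith
      exact_mod_cast this
    refine ⟨l, ⟨fun x hx => ?_, hm, ?_⟩, rfl⟩
    · have hx0 : ¬ (κ : ℤ) ∣ x := fun h =>
        h0 _ (List.mem_map_of_mem hx) ((ZMod.intCast_zmod_eq_zero_iff_dvd x κ).mpr h)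
      have hle := le_posSum_and_neg_le_negSum hx
      have h1 : x ≠ 0 := fun h => hx0 (h ▸ dvd_zero _)
      have h2 : x ≠ κ := fun h => hx0 (h ▸ dvd_rfl)
      have h3 : x ≠ -κ := fun h => hx0 (h ▸ (dvd_neg.mpr dvd_rfl))
      exact ⟨h1, abs_lt.mpr (by omega)⟩
    · rw [cast_sum] at hs
      exact (ZMod.intCast_zmod_eq_zero_iff_dvd _ κ).mp hs
  · rintro ⟨l, ⟨h0, hm, hd⟩, rfl⟩
    refine ⟨fun b hb => ?_, ?_, l.map fun k : ℤ => -(k : ℚ) / 2, ⟨fun x hx => ?_, ?_⟩,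
      (forall₂_eqNegTwoMulMod_iff _ _).mpr ⟨l, rfl, rfl⟩⟩
    · obtain ⟨x, hx, rfl⟩ := List.mem_map.mp hb
      intro h
      exact (h0 x hx).1 (Int.eq_zero_of_abs_lt_dvd
        ((ZMod.intCast_zmod_eq_zero_iff_dvd x κ).mp h) (h0 x hx).2)
    · rw [cast_sum]
      exact (ZMod.intCast_zmod_eq_zero_iff_dvd _ κ).mpr hd
    · obtain ⟨k, -, rfl⟩ := List.mem_map.mp hx
      exact ⟨-k, by push_cast; ring⟩
    · rw [sum_abs_spins, hm]

theorem levelLists_finite (κ : ℕ) : (levelLists κ).Finite := by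
  refine (Set.Finite.biUnion (Finset.range (κ + 1)).finite_toSet fun i _ =>
    signedCompositions_finite i (κ - i)).subset fun l hl => ?_
  obtain ⟨h0, hm, -⟩ := hl
  simp only [Set.mem_iUnion]
  exact ⟨posSum l, by simp; omega, fun h => (h0 0 h).1 rfl, rfl, by omega⟩

theorem permissibleBLists_finite (κ : ℕ) : (permissibleBLists κ).Finite := by
  rw [permissibleBLists_eq_image]
  exact (levelLists_finite κ).image _

theorem posSum_negSum_of_mem_levelLists {κ : ℕ} (hκ : 1 ≤ κ) {l : List ℤ} (hl : l ∈ levelLists κ) :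
    posSum l = κ ∧ negSum l = 0 ∨ posSum l = 0 ∧ negSum l = κ ∨
      2 * posSum l = κ ∧ 2 * negSum l = κ := by
  obtain ⟨-, hm, q, hq⟩ := hl
  rw [sum_eq_posSum_sub_negSum] at hq
  have hκ' : (0 : ℤ) < κ := by exact_mod_cast hκ
  have h1 : q ≤ 1 := by
    by_contra! h
    have : (κ : ℤ) * 2 ≤ κ * q := mul_le_mul_of_nonneg_left h hκ'.le
    omega
  have h2 : -1 ≤ q := by
    by_contra! h
    have : (κ : ℤ) * q ≤ κ * (-2) := mul_le_mul_of_nonneg_left (by omega) hκ'.le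
    omega
  have : q = -1 ∨ q = 0 ∨ q = 1 := by omega
  rcases this with rfl | rfl | rfl <;> omega

/-! ### Integer lists with equal residues -/

/-- Entries of absolute value less than `κ` in the same residue class have opposite signs and
absolute values summing to `κ`, if they are distinct. -/
theorem abs_add_abs_of_cast_eq {κ : ℕ} {x y : ℤ} (hx : x ≠ 0 ∧ |x| < κ) (hy : y ≠ 0 ∧ |y| < κ)
    (h : (x : ZMod κ) = y) (hne : x ≠ y) :
    0 < x ∧ y < 0 ∧ x - y = κ ∨ x < 0 ∧ 0 < y ∧ y - x = κ := by
  obtain ⟨q, hq⟩ := (ZMod.intCast_eq_intCast_iff_dvd_sub x y κ).mp h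
  obtain ⟨hx0, hx1⟩ := hx
  obtain ⟨hy0, hy1⟩ := hy
  rw [abs_lt] at hx1 hy1
  have hκ' : (0 : ℤ) < κ := by omega
  have h1 : q < 2 := by
    by_contra! h
    have : (κ : ℤ) * 2 ≤ κ * q := mul_le_mul_of_nonneg_left h hκ'.le
    omega
  have h2 : -2 < q := by
    by_contra! h
    have : (κ : ℤ) * q ≤ κ * (-2) := mul_le_mul_of_nonneg_left h hκ'.le
    omega
  have : q = -1 ∨ q = 0 ∨ q = 1 := by omega
  rcases this with rfl | rfl | rfl <;> omega

/-- Two lists with the same residues are equal, or they differ in exactly one place, or they differ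
in at least two places; in the last case the two differing pairs contribute `2 κ` and every other
entry contributes at least `2` to the two sums of absolute values. -/
theorem eq_or_differ_once_or_le {κ : ℕ} {l l' : List ℤ} (hl : ∀ x ∈ l, x ≠ 0 ∧ |x| < κ)
    (hl' : ∀ x ∈ l', x ≠ 0 ∧ |x| < κ)
    (h : l.map (Int.cast : ℤ → ZMod κ) = l'.map Int.cast) :
    l = l' ∨
      (∃ (p s : List ℤ) (x y : ℤ), l = p ++ x :: s ∧ l' = p ++ y :: s ∧
        (0 < x ∧ y < 0 ∧ x - y = κ ∨ x < 0 ∧ 0 < y ∧ y - x = κ)) ∨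
      2 * κ + l.length ≤ posSum l + negSum l + (posSum l' + negSum l') + 2 := by
  induction l generalizing l' with
  | nil =>
    left
    simpa using h.symm
  | cons x l ih =>
    cases l' with
    | nil => simp at h
    | cons y l' =>
      simp only [List.map_cons, List.cons.injEq] at h
      simp only [List.forall_mem_cons] at hl hl'
      simp only [posSum_cons, negSum_cons, List.length_cons]
      rcases eq_or_ne x y with rfl | hne
      · rcases ih hl.2 hl'.2 h.2 with rfl | ⟨p, s, u, v, rfl, rfl, huv⟩ | hle
        · exact Or.inl rfl
        · exact Or.inr (Or.inl ⟨x :: p, s, u, v, rfl, rfl, huv⟩)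
        · have := hl.1.1
          right; right
          omega
      · have hxy := abs_add_abs_of_cast_eq hl.1 hl'.1 h.1 hne
        rcases ih hl.2 hl'.2 h.2 with rfl | ⟨p, s, u, v, rfl, rfl, huv⟩ | hle
        · exact Or.inr (Or.inl ⟨[], l, x, y, rfl, rfl, hxy⟩)
        · right; right
          have h1 := length_le_posSum_add_negSum (l := p) fun h =>
            (hl.2 0 (List.mem_append_left _ h)).1 rfl
          have h2 := length_le_posSum_add_negSum (l := s) fun h =>
            (hl.2 0 (List.mem_append_right _ (List.mem_cons_of_mem _ h))).1 rfl
          simp only [posSum_append, negSum_append, posSum_cons, negSum_cons, List.length_append,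
            List.length_cons]
          omega
        · right; right
          omega

/-- Non-negative lists are determined by their residues. -/
theorem eq_of_map_cast_eq_of_negSum_eq_zero {κ : ℕ} {l l' : List ℤ}
    (hl : ∀ x ∈ l, x ≠ 0 ∧ |x| < κ) (hl' : ∀ x ∈ l', x ≠ 0 ∧ |x| < κ)
    (h : l.map (Int.cast : ℤ → ZMod κ) = l'.map Int.cast) (hn : negSum l = 0)
    (hn' : negSum l' = 0) : l = l' := by
  induction l generalizing l' with
  | nil => simpa using h.symm
  | cons x l ih =>
    cases l' with
    | nil => simp at h
    | cons y l' =>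
      simp only [List.map_cons, List.cons.injEq] at h
      simp only [List.forall_mem_cons] at hl hl'
      rw [negSum_cons] at hn hn'
      rw [ih hl.2 hl'.2 h.2 (by omega) (by omega)]
      by_contra hne
      have hxy : x ≠ y := fun h => hne (by rw [h])
      have := abs_add_abs_of_cast_eq hl.1 hl'.1 h.1 hxy
      omega

/-- Representatives of the permissible lists among the integer lists: all entries positive; or all
entries negative and at least three of them; or at least two entries of each sign. -/
def canonicalLists (κ : ℕ) : Set (List ℤ) :=
  {l | l ∈ levelLists κ ∧ (negSum l = 0 ∨ posSum l = 0 ∧ 3 ≤ l.length ∨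
    2 ≤ posCount l ∧ 2 ≤ negCount l)}

theorem not_mem_canonicalLists_of_differ_once {κ : ℕ} (hκ : 1 ≤ κ) {p s : List ℤ} {x y : ℤ}
    (hx : 0 < x) (hy : y < 0) (hxy : x - y = κ) (hl : p ++ x :: s ∈ canonicalLists κ)
    (hl' : p ++ y :: s ∈ canonicalLists κ) : False := by
  obtain ⟨hl, hc⟩ := hl
  obtain ⟨hl', hc'⟩ := hl'
  have h1 := posSum_negSum_of_mem_levelLists hκ hl
  have h2 := posSum_negSum_of_mem_levelLists hκ hl'
  have p1 := posCount_eq_zero_iff (l := p)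
  have p2 := posCount_eq_zero_iff (l := s)
  have n1 := negCount_eq_zero_iff (l := p)
  have n2 := negCount_eq_zero_iff (l := s)
  simp only [posSum_append, negSum_append, posSum_cons, negSum_cons, posCount_append,
    posCount_cons, negCount_append, negCount_cons, if_pos hx, if_pos hy, if_neg hx.not_gt,
    if_neg hy.not_gt] at h1 h2 hc hc'
  omega

theorem injOn_canonicalLists {κ : ℕ} (hκ : 1 ≤ κ) :
    Set.InjOn (List.map (Int.cast : ℤ → ZMod κ)) (canonicalLists κ) := by
  intro l hl l' hl' h
  have hlen := congrArg List.length h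
  rw [List.length_map, List.length_map] at hlen
  rcases eq_or_differ_once_or_le hl.1.1 hl'.1.1 h with
    h' | ⟨p, s, x, y, rfl, rfl, ⟨hx, hy, hxy⟩ | ⟨hx, hy, hxy⟩⟩ | h'
  · exact h'
  · exact (not_mem_canonicalLists_of_differ_once hκ hx hy hxy hl hl').elim
  · exact (not_mem_canonicalLists_of_differ_once hκ hy hx hxy hl' hl).elim
  · have h1 := hl.1.2.1
    have h2 := hl'.1.2.1
    -- The canonical lists of length at most two have no negative entry.
    have key : ∀ t ∈ canonicalLists κ, t.length ≤ 2 → negSum t = 0 := by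
      rintro t ⟨ht, hc⟩ h2
      have := posCount_add_negCount (l := t) fun h => (ht.1 0 h).1 rfl
      omega
    exact eq_of_map_cast_eq_of_negSum_eq_zero hl.1.1 hl'.1.1 h (key l hl (by omega))
      (key l' hl' (by omega))

theorem exists_split_of_countP_eq_one {α : Type*} {P : α → Bool} {l : List α}
    (h : l.countP P = 1) :
    ∃ p x s, l = p ++ x :: s ∧ P x ∧ p.countP P = 0 ∧ s.countP P = 0 := by
  induction l with
  | nil => simp at h
  | cons y l ih =>
    rw [List.countP_cons] at h
    by_cases hy : P y
    · rw [if_pos hy] at h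
      exact ⟨[], y, l, rfl, hy, rfl, by omega⟩
    · rw [if_neg hy] at h
      obtain ⟨p, x, s, rfl, hx, hp, hs⟩ := ih h
      exact ⟨y :: p, x, s, rfl, hx, by rw [List.countP_cons, if_neg hy, hp], hs⟩

/-- Two negative entries `x`, `y` with `x + y = -κ` have the residues of the positive entries
`x + κ`, `y + κ`, whose sum is `κ`. -/
theorem exists_canonical_of_length_le_two {κ : ℕ} (hκ : 1 ≤ κ) {l : List ℤ}
    (hl : l ∈ levelLists κ) (hp : posSum l = 0) (hlen : l.length ≤ 2) :
    ∃ l' ∈ canonicalLists κ, l'.map (Int.cast : ℤ → ZMod κ) = l.map Int.cast := by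
  obtain ⟨h0, hs, -⟩ := hl
  match l, hlen with
  | [], _ => simp at hs; omega
  | [x], _ =>
    have := h0 x (by simp)
    simp only [posSum_cons, negSum_cons, posSum_nil, negSum_nil] at hs hp
    rw [abs_lt] at this
    omega
  | [x, y], _ =>
    have hx := h0 x (by simp)
    have hy := h0 y (by simp)
    simp only [posSum_cons, negSum_cons, posSum_nil, negSum_nil] at hs hp
    rw [abs_lt] at hx hy
    refine ⟨[x + κ, y + κ], ⟨⟨?_, ?_, ?_⟩, Or.inl ?_⟩, by simp⟩
    · intro z hz
      rw [abs_lt]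
      simp only [List.mem_cons, List.not_mem_nil, or_false] at hz
      omega
    · simp only [posSum_cons, negSum_cons, posSum_nil, negSum_nil]
      omega
    · exact ⟨1, by simp; omega⟩
    · simp only [negSum_cons, negSum_nil]
      omega

/-- For `κ = 2 u`, the entries `u` and `-u` are congruent mod `κ` and may replace each other. -/
theorem replace_mem_levelLists {κ : ℕ} {p s : List ℤ} {x : ℤ} (hx : |2 * x| = κ)
    (hl : p ++ x :: s ∈ levelLists κ) :
    p ++ (-x) :: s ∈ levelLists κ ∧
      (p ++ (-x) :: s).map (Int.cast : ℤ → ZMod κ) = (p ++ x :: s).map Int.cast := by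
  have hdvd : (κ : ℤ) ∣ 2 * x := by rw [← hx, abs_dvd]
  obtain ⟨h0, hs, hd⟩ := hl
  refine ⟨⟨?_, ?_, ?_⟩, ?_⟩
  · intro z hz
    simp only [List.mem_append, List.mem_cons] at hz h0
    rcases hz with hz | rfl | hz
    · exact h0 z (Or.inl hz)
    · rw [abs_neg, neg_ne_zero]
      exact h0 x (Or.inr (Or.inl rfl))
    · exact h0 z (Or.inr (Or.inr hz))
  · simp only [posSum_append, negSum_append, posSum_cons, negSum_cons, neg_neg] at hs ⊢
    omega
  · have : (p ++ (-x) :: s).sum = (p ++ x :: s).sum - 2 * x := by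
      simp only [List.sum_append, List.sum_cons]
      ring
    rw [this]
    exact dvd_sub hd hdvd
  · have : ((2 * x : ℤ) : ZMod κ) = 0 := (ZMod.intCast_zmod_eq_zero_iff_dvd _ κ).mpr hdvd
    have : ((-x : ℤ) : ZMod κ) = x := by
      push_cast at this ⊢
      linear_combination -this
    simp [this]

/-- A list with both signs and a single entry of one sign has `± κ / 2` as that entry; changing the
sign of this entry gives a list with entries of one sign only. -/
theorem exists_canonical {κ : ℕ} (hκ : 1 ≤ κ) {l : List ℤ} (hl : l ∈ levelLists κ) :
    ∃ l' ∈ canonicalLists κ, l'.map (Int.cast : ℤ → ZMod κ) = l.map Int.cast := by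
  by_cases hc : l ∈ canonicalLists κ
  · exact ⟨l, hc, rfl⟩
  have hc' : ¬ (negSum l = 0 ∨ posSum l = 0 ∧ 3 ≤ l.length ∨ 2 ≤ posCount l ∧ 2 ≤ negCount l) :=
    fun h => hc ⟨hl, h⟩
  have h1 := posSum_negSum_of_mem_levelLists hκ hl
  by_cases hp : posSum l = 0
  · exact exists_canonical_of_length_le_two hκ hl hp (by omega)
  have hp' := mt posCount_eq_zero_iff.mp hp
  have hn : negSum l ≠ 0 := by omega
  have hn' := mt negCount_eq_zero_iff.mp hn
  have hlen := posCount_add_negCount (l := l) fun h => (hl.1 0 h).1 rfl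
  by_cases hnc : negCount l = 1
  · obtain ⟨p, x, s, rfl, hx, np, ns⟩ := exists_split_of_countP_eq_one hnc
    have hx : x < 0 := by simpa using hx
    have np : negSum p = 0 := negCount_eq_zero_iff.mp np
    have ns : negSum s = 0 := negCount_eq_zero_iff.mp ns
    simp only [posSum_append, negSum_append, posSum_cons, negSum_cons] at h1 hp hn
    obtain ⟨h2, h3⟩ := replace_mem_levelLists (x := x) (by rw [abs_of_neg (by omega)]; omega) hl
    refine ⟨_, ⟨h2, Or.inl ?_⟩, h3⟩
    simp only [negSum_append, negSum_cons]
    omega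
  · have hpc : posCount l = 1 := by omega
    obtain ⟨p, x, s, rfl, hx, np, ns⟩ := exists_split_of_countP_eq_one hpc
    have hx : 0 < x := by simpa using hx
    have np : posSum p = 0 := posCount_eq_zero_iff.mp np
    have ns : posSum s = 0 := posCount_eq_zero_iff.mp ns
    rw [List.length_append, List.length_cons] at hlen
    simp only [posSum_append, negSum_append, posSum_cons, negSum_cons] at h1 hp hn
    obtain ⟨h2, h3⟩ := replace_mem_levelLists (x := x) (by rw [abs_of_pos (by omega)]; omega) hl
    refine ⟨_, ⟨h2, Or.inr (Or.inl ⟨?_, ?_⟩)⟩, h3⟩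
    · simp only [posSum_append, posSum_cons]
      omega
    · rw [List.length_append, List.length_cons]
      omega

theorem ncard_permissibleBLists {κ : ℕ} (hκ : 1 ≤ κ) :
    (permissibleBLists κ).ncard = (canonicalLists κ).ncard := by
  have : permissibleBLists κ = List.map (Int.cast : ℤ → ZMod κ) '' canonicalLists κ := by
    rw [permissibleBLists_eq_image]
    refine Set.Subset.antisymm ?_ (Set.image_mono fun l hl => hl.1)
    rintro _ ⟨l, hl, rfl⟩
    exact exists_canonical hκ hl
  rw [this, (injOn_canonicalLists hκ).ncard_image]

/-! ### The number of permissible lists -/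

/-- In a list of two or more non-zero entries, no entry exhausts the total `κ`, so the bound on the
entries amounts to a bound on the length. -/
theorem mem_levelLists_iff {κ : ℕ} {l : List ℤ} :
    l ∈ levelLists κ ↔
      0 ∉ l ∧ 2 ≤ l.length ∧ posSum l + negSum l = κ ∧ (κ : ℤ) ∣ l.sum ∨ l = [] ∧ κ = 0 := by
  constructor
  · rintro ⟨h0, hs, hd⟩
    match l with
    | [] => exact Or.inr ⟨rfl, hs.symm⟩
    | [x] =>
      have := (h0 x (by simp)).2
      rw [abs_lt] at this
      simp only [posSum_cons, negSum_cons, posSum_nil, negSum_nil] at hs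
      omega
    | x :: y :: l => exact Or.inl ⟨fun h => (h0 0 h).1 rfl, by simp, hs, hd⟩
  · rintro (⟨h0, hlen, hs, hd⟩ | ⟨rfl, rfl⟩)
    · refine ⟨fun x hx => ⟨fun h => h0 (h ▸ hx), ?_⟩, hs, hd⟩
      obtain ⟨p, s, rfl⟩ := List.append_of_mem hx
      have h1 := length_le_posSum_add_negSum (l := p) fun h => h0 (List.mem_append_left _ h)
      have h2 := length_le_posSum_add_negSum (l := s) fun h =>
        h0 (List.mem_append_right _ (List.mem_cons_of_mem _ h))
      simp only [posSum_append, negSum_append, posSum_cons, negSum_cons, List.length_append,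
        List.length_cons] at hs hlen
      rw [abs_lt]
      omega
    · simp [levelLists]

theorem ncard_allPositive (n : ℕ) :
    ({l | l ∈ signedCompositions (n + 1) 0 ∧ 2 ≤ l.length}.ncard : ℝ) = 2 ^ n - 1 := by
  have hs : {l | l ∈ signedCompositions (n + 1) 0 ∧ 2 ≤ l.length} =
      signedCompositions (n + 1) 0 \ {[(n : ℤ) + 1]} := by
    ext l
    constructor
    · rintro ⟨h, h2⟩
      refine ⟨h, ?_⟩
      rintro rfl
      simp at h2
    · rintro ⟨h, h2⟩
      refine ⟨h, ?_⟩
      obtain ⟨h0, hi, hj⟩ := h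
      match l with
      | [] => simp at hi
      | [x] =>
        simp only [posSum_cons, negSum_cons, posSum_nil, negSum_nil] at hi hj
        refine (h2 ?_).elim
        rw [Set.mem_singleton_iff]
        congr 1
        omega
      | x :: y :: l => simp
  have hmem : [(n : ℤ) + 1] ∈ signedCompositions (n + 1) 0 := by
    refine ⟨?_, ?_, ?_⟩
    · simp only [List.mem_singleton]; omega
    · simp only [posSum_cons, posSum_nil]; omega
    · simp only [negSum_cons, negSum_nil]; omega
  have h := Set.ncard_sdiff_singleton_add_one hmem (signedCompositions_finite _ _)
  rw [← hs, ncard_signedCompositions_succ_zero] at h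
  have h' := congrArg (Nat.cast (R := ℝ)) h
  push_cast at h'
  linarith

/-- The lists of length at most two that are left out are `[-(n + 1)]` and the `n` lists
`[-(a + 1), -(n - a)]`. -/
theorem ncard_allNegative (n : ℕ) :
    ({l | l ∈ signedCompositions 0 (n + 1) ∧ 3 ≤ l.length}.ncard : ℝ) = 2 ^ n - n - 1 := by
  let T : Set (List ℤ) := (fun a : ℕ => [-((a : ℤ) + 1), -((n : ℤ) - a)]) '' (Finset.range n : Set ℕ)
  have hT : T.ncard = n := by
    rw [Set.ncard_image_of_injective, Set.ncard_coe_finset, Finset.card_range]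
    intro a b h
    have : -((a : ℤ) + 1) = -((b : ℤ) + 1) := (List.cons.inj h).1
    omega
  have hTf : T.Finite := (Finset.finite_toSet _).image _
  have hnot : [-((n : ℤ) + 1)] ∉ T := by
    rintro ⟨a, -, h⟩
    simp at h
  have hsub : insert [-((n : ℤ) + 1)] T ⊆ signedCompositions 0 (n + 1) := by
    rintro _ (rfl | ⟨a, ha, rfl⟩)
    · refine ⟨?_, ?_, ?_⟩
      · simp only [List.mem_singleton]; omega
      · simp only [posSum_cons, posSum_nil]; omega
      · simp only [negSum_cons, negSum_nil]; omega
    · have ha : a < n := by simpa using ha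
      refine ⟨?_, ?_, ?_⟩
      · simp only [List.mem_cons, List.not_mem_nil, or_false]; omega
      · simp only [posSum_cons, posSum_nil]; omega
      · simp only [negSum_cons, negSum_nil]; omega
  have hs : {l | l ∈ signedCompositions 0 (n + 1) ∧ 3 ≤ l.length} =
      signedCompositions 0 (n + 1) \ insert [-((n : ℤ) + 1)] T := by
    ext l
    constructor
    · rintro ⟨h, h3⟩
      refine ⟨h, ?_⟩
      rintro (rfl | ⟨a, -, rfl⟩) <;> simp at h3
    · rintro ⟨h, h3⟩
      refine ⟨h, ?_⟩
      obtain ⟨h0, hi, hj⟩ := h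
      match l with
      | [] => simp at hj
      | [x] =>
        simp only [posSum_cons, negSum_cons, posSum_nil, negSum_nil] at hi hj
        refine (h3 (Or.inl ?_)).elim
        congr 1
        omega
      | [x, y] =>
        simp only [List.mem_cons, List.not_mem_nil, or_false, not_or] at h0
        simp only [posSum_cons, negSum_cons, posSum_nil, negSum_nil] at hi hj
        refine (h3 (Or.inr ⟨(-x).toNat - 1, ?_, ?_⟩)).elim
        · simp only [Finset.coe_range, Set.mem_Iio]; omega
        · simp only [List.cons.injEq, and_true]; omega
      | x :: y :: z :: l => simp
  have h := Set.ncard_sdiff_add_ncard_of_subset hsub (signedCompositions_finite _ _)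
  rw [← hs, Set.ncard_insert_of_notMem hnot hTf, hT, ncard_signedCompositions_comm,
    ncard_signedCompositions_succ_zero] at h
  have h' := congrArg (Nat.cast (R := ℝ)) h
  push_cast at h'
  linarith

/-- The canonical lists split into three disjoint families, according to the signs that occur. -/
theorem ncard_canonicalLists (n : ℕ) :
    ((canonicalLists (n + 1)).ncard : ℝ) = 2 ^ (n + 1) - n - 2 +
      ({l | l ∈ levelLists (n + 1) ∧ 2 ≤ posCount l ∧ 2 ≤ negCount l}.ncard : ℝ) := by
  have hs : canonicalLists (n + 1) =
      {l | l ∈ signedCompositions (n + 1) 0 ∧ 2 ≤ l.length} ∪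
        ({l | l ∈ signedCompositions 0 (n + 1) ∧ 3 ≤ l.length} ∪
          {l | l ∈ levelLists (n + 1) ∧ 2 ≤ posCount l ∧ 2 ≤ negCount l}) := by
    ext l
    constructor
    · rintro ⟨hl, h⟩
      have hl' := hl
      rw [mem_levelLists_iff] at hl'
      obtain ⟨h0, hlen, hs, -⟩ := hl'.resolve_right (by omega)
      rcases h with h | h | h
      · exact Or.inl ⟨⟨h0, by omega, h⟩, hlen⟩
      · exact Or.inr (Or.inl ⟨⟨h0, h.1, by omega⟩, h.2⟩)
      · exact Or.inr (Or.inr ⟨hl, h⟩)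
    · rintro (⟨⟨h0, hi, hj⟩, hlen⟩ | ⟨⟨h0, hi, hj⟩, hlen⟩ | ⟨hl, h⟩)
      · refine ⟨mem_levelLists_iff.mpr (Or.inl ⟨h0, hlen, by omega, ?_⟩), Or.inl hj⟩
        rw [sum_eq_posSum_sub_negSum, hi, hj]
        simp
      · refine ⟨mem_levelLists_iff.mpr (Or.inl ⟨h0, by omega, by omega, ?_⟩), Or.inr (Or.inl ⟨hi, hlen⟩)⟩
        rw [sum_eq_posSum_sub_negSum, hi, hj]
        simp only [Nat.cast_zero, zero_sub, dvd_neg, dvd_refl]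
      · exact ⟨hl, Or.inr (Or.inr h)⟩
  have f1 : {l | l ∈ signedCompositions (n + 1) 0 ∧ 2 ≤ l.length}.Finite :=
    (signedCompositions_finite _ _).subset fun _ h => h.1
  have f2 : {l | l ∈ signedCompositions 0 (n + 1) ∧ 3 ≤ l.length}.Finite :=
    (signedCompositions_finite _ _).subset fun _ h => h.1
  have f3 : {l | l ∈ levelLists (n + 1) ∧ 2 ≤ posCount l ∧ 2 ≤ negCount l}.Finite :=
    (levelLists_finite _).subset fun _ h => h.1
  rw [hs, Set.ncard_union_eq _ f1 (f2.union f3), Set.ncard_union_eq _ f2 f3]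
  · push_cast
    rw [ncard_allPositive, ncard_allNegative]
    ring
  · rw [Set.disjoint_left]
    rintro l ⟨⟨-, hi, -⟩, -⟩ ⟨-, hp, -⟩
    have := posCount_eq_zero_iff.mpr hi
    omega
  · rw [Set.disjoint_left]
    rintro l ⟨⟨-, hi, hj⟩, -⟩ (⟨⟨-, hi', -⟩, -⟩ | ⟨-, -, hn⟩)
    · omega
    · have := negCount_eq_zero_iff.mpr hj
      omega

theorem ncard_permissibleBLists_odd (u : ℕ) :
    ((permissibleBLists (2 * u + 1)).ncard : ℝ) = 2 ^ (2 * u + 1) - 2 * u - 2 := by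
  have : {l | l ∈ levelLists (2 * u + 1) ∧ 2 ≤ posCount l ∧ 2 ≤ negCount l} = ∅ := by
    ext l
    refine ⟨fun ⟨hl, hp, hn⟩ => ?_, False.elim⟩
    have h1 := posSum_negSum_of_mem_levelLists (by omega) hl
    have h2 := mt posCount_eq_zero_iff.mpr (show posCount l ≠ 0 by omega)
    have h3 := mt negCount_eq_zero_iff.mpr (show negCount l ≠ 0 by omega)
    omega
  rw [ncard_permissibleBLists (by omega), ncard_canonicalLists, this, Set.ncard_empty]
  push_cast
  ring

theorem ncard_permissibleBLists_even (n : ℕ) :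
    ((permissibleBLists (2 * (n + 1))).ncard : ℝ) =
      (signedCompositions (n + 1) (n + 1)).ncard + 2 ^ (2 * (n + 1)) - 2 ^ n * (n + 4) -
        2 * (n + 1) + 1 := by
  have : {l | l ∈ levelLists (2 * n + 1 + 1) ∧ 2 ≤ posCount l ∧ 2 ≤ negCount l} =
      {l | l ∈ signedCompositions (n + 1) (n + 1) ∧ 2 ≤ posCount l ∧ 2 ≤ negCount l} := by
    ext l
    constructor
    · rintro ⟨hl, hp, hn⟩
      have h1 := posSum_negSum_of_mem_levelLists (by omega) hl
      have h2 := mt posCount_eq_zero_iff.mpr (show posCount l ≠ 0 by omega)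
      have h3 := mt negCount_eq_zero_iff.mpr (show negCount l ≠ 0 by omega)
      exact ⟨⟨fun h => (hl.1 0 h).1 rfl, by omega, by omega⟩, hp, hn⟩
    · rintro ⟨⟨h0, hi, hj⟩, hp, hn⟩
      have hlen := posCount_add_negCount h0
      refine ⟨mem_levelLists_iff.mpr (Or.inl ⟨h0, by omega, by omega, ?_⟩), hp, hn⟩
      rw [sum_eq_posSum_sub_negSum, hi, hj]
      simp
  rw [ncard_permissibleBLists (by omega), show 2 * (n + 1) = 2 * n + 1 + 1 by ring,
    ncard_canonicalLists, this, ncard_twoNegative_twoPositive]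
  push_cast
  ring

/-! ### The entropy -/

theorem sqrtQuotientCoeff_succ (n : ℕ) :
    sqrtQuotientCoeff (n + 1) = 2 * (signedCompositions (n + 1) (n + 1)).ncard := by
  induction n using Nat.strong_induction_on with
  | _ n ih =>
    match n with
    | 0 =>
      rw [sqrtQuotientCoeff_one, ncard_signedCompositions_one_one]
      norm_num
    | 1 =>
      have := sqrtQuotientCoeff_rec 0
      rw [zero_add, sqrtQuotientCoeff_one] at this
      rw [ncard_signedCompositions_two_two]
      norm_num at this ⊢
      linarith
    | n + 2 =>
      have h1 := sqrtQuotientCoeff_rec (n + 1)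
      have h2 := ncard_signedCompositions_diagonal_rec n
      rw [ih (n + 1) (by omega), ih n (by omega)] at h1
      have hne : (n : ℝ) + 3 ≠ 0 := by positivity
      refine mul_left_cancel₀ hne ?_
      push_cast at h1
      linear_combination h1 - 2 * h2

theorem entropy_of_eq {κ : ℕ} {x : ℝ} (h : x = (permissibleBLists κ).ncard + 1) :
    0 < x ∧ blackHoleEntropy κ = Real.log x := by
  subst h
  exact ⟨by positivity, rfl⟩

theorem theorem1 :
    (∀ κ : ℕ, 1 ≤ κ → (permissibleBLists κ).Finite) ∧
    (∀ u : ℕ, 1 ≤ u →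
      0 < (-1 : ℝ) ^ u * Real.sqrt Real.pi /
            (4 * Real.Gamma (3 / 2 - (u : ℝ)) * (Nat.factorial u : ℝ)) *
            ordinaryHypergeometric (1 / 2 : ℝ) (-(u : ℝ)) (3 / 2 - (u : ℝ)) (9 : ℝ)
          + (2 : ℝ) ^ (2 * u) - (2 : ℝ) ^ ((u : ℤ) - 1) * ((u : ℝ) + 3) - 2 * (u : ℝ) + 2 ∧
      blackHoleEntropy (2 * u) =
        Real.log
          ((-1 : ℝ) ^ u * Real.sqrt Real.pi /
            (4 * Real.Gamma (3 / 2 - (u : ℝ)) * (Nat.factorial u : ℝ)) *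
            ordinaryHypergeometric (1 / 2 : ℝ) (-(u : ℝ)) (3 / 2 - (u : ℝ)) (9 : ℝ)
          + (2 : ℝ) ^ (2 * u) - (2 : ℝ) ^ ((u : ℤ) - 1) * ((u : ℝ) + 3) - 2 * (u : ℝ) + 2)) ∧
    (∀ u : ℕ,
      0 < (2 : ℝ) ^ (2 * u + 1) - 2 * (u : ℝ) - 1 ∧
      blackHoleEntropy (2 * u + 1) =
        Real.log ((2 : ℝ) ^ (2 * u + 1) - 2 * (u : ℝ) - 1)) := by
  refine ⟨fun κ _ => permissibleBLists_finite κ, fun u hu => entropy_of_eq ?_,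
    fun u => entropy_of_eq ?_⟩
  · obtain ⟨n, rfl⟩ : ∃ n, u = n + 1 := ⟨u - 1, by omega⟩
    rw [hypergeometric_term_eq, sqrtQuotientCoeff_succ, ncard_permissibleBLists_even,
      show ((n + 1 : ℕ) : ℤ) - 1 = (n : ℤ) by push_cast; ring, zpow_natCast]
    push_cast
    ring
  · rw [ncard_permissibleBLists_odd]
    ring
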